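/- Let $(X,d)$ be a $\mathrm{CAT}(-1)$ space. That is, $X$ is a metric space such that any two points $p,q\in X$ are joined by a geodesic segment (the image of an isometric embedding of $[0,d(p,q)]$ sending $0$ to $p$ and $d(p,q)$ to $q$), and every geodesic triangle $\Delta$ in $X$ satisfies the following: if $\bar\Delta$ is a comparison triangle in the hyperbolic plane $\mathbb{H}^2$ of curvature $-1$ (a triangle with the same side lengths), then $d(x,y)\le d_{\mathbb{H}^2}(\bar x,\bar y)$ for all points $x,y$ on the sides of $\Delta$ and their comparison points $\bar x,\bar y$ on the corresponding sides of $\bar\Delta$ (the comparison point being the one at the same distances from the end points of the side). Then $X$ is strongly hyperbolic with parameter $1$: for all $x,y,z,o\in X$, $$\exp\big(-(x,y)_o\big)\le \exp\big(-(x,z)_o\big)+\exp\big(-(z,y)_o\big),$$ where $(x,y)_o=\tfrac12\big(d(x,o)+d(y,o)-d(x,y)\big)$ denotes the Gromov product. -/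

import Mathlib

/-- The Gromov product `(x, y)_o = (|x,o| + |y,o| - |x,y|) / 2` in a metric space. -/
noncomputable def gromovProduct {X : Type*} [MetricSpace X] (o x y : X) : ℝ :=
  (dist x o + dist y o - dist x y) / 2

/-- A metric space is strongly hyperbolic with parameter `ε > 0` if
`exp (-ε (x,y)_o) ≤ exp (-ε (x,z)_o) + exp (-ε (z,y)_o)` for all `x, y, z, o`. -/
def StronglyHyperbolic (X : Type*) [MetricSpace X] (ε : ℝ) : Prop :=
  0 < ε ∧ ∀ x y z o : X,
    Real.exp (-ε * gromovProduct o x y) ≤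
      Real.exp (-ε * gromovProduct o x z) + Real.exp (-ε * gromovProduct o z y)

/-- `S` is a geodesic segment joining `p` to `q`: the image of an isometric embedding of the
interval `[0, |p,q|]` which sends `0` to `p` and `|p,q|` to `q`. -/
def IsGeodesicSegment {X : Type*} [MetricSpace X] (p q : X) (S : Set X) : Prop :=
  ∃ γ : ℝ → X, γ 0 = p ∧ γ (dist p q) = q ∧
    (∀ s ∈ Set.Icc 0 (dist p q), ∀ t ∈ Set.Icc 0 (dist p q), dist (γ s) (γ t) = |s - t|) ∧
    S = γ '' Set.Icc 0 (dist p q)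

/-- A geodesic metric space: any two points are joined by a geodesic segment. -/
def IsGeodesicSpace (X : Type*) [MetricSpace X] : Prop :=
  ∀ p q : X, ∃ S : Set X, IsGeodesicSegment p q S

/-- A geodesic triangle: three vertices, together with a choice of three geodesic segments (the
sides), where `side i` joins `vertex i` to `vertex (i + 1)`, indices being taken modulo `3`. -/
structure GeodesicTriangle (X : Type*) [MetricSpace X] where
  vertex : Fin 3 → X
  side : Fin 3 → Set X
  isGeodesicSegment_side : ∀ i, IsGeodesicSegment (vertex i) (vertex (i + 1)) (side i)

namespace GeodesicTriangle

/-- `v` lists the vertices of a comparison triangle in the hyperbolic plane, i.e. one with the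
same side lengths as `Δ`. `UpperHalfPlane` carries the hyperbolic metric of curvature `-1`. -/
def IsComparisonTriangle {X : Type*} [MetricSpace X] (Δ : GeodesicTriangle X)
    (v : Fin 3 → UpperHalfPlane) : Prop :=
  ∀ i, dist (v i) (v (i + 1)) = dist (Δ.vertex i) (Δ.vertex (i + 1))

/-- `x'` is the comparison point, in the comparison triangle with vertices `v`, of the point `x`
of the `i`-th side of `Δ`: the point of the `i`-th side of the comparison triangle at the same
distances from the end points of that side as `x`. As `x` is on a geodesic segment, these two
distances add up to the length of the side, so `x'` is on the hyperbolic segment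
from `v i` to `v (i + 1)`. -/
def IsComparisonPoint {X : Type*} [MetricSpace X] (Δ : GeodesicTriangle X)
    (v : Fin 3 → UpperHalfPlane) (i : Fin 3) (x : X) (x' : UpperHalfPlane) : Prop :=
  dist (v i) x' = dist (Δ.vertex i) x ∧ dist x' (v (i + 1)) = dist x (Δ.vertex (i + 1))

end GeodesicTriangle

/-- A `CAT(-1)` space: a geodesic metric space in which every geodesic triangle is at least as thin
as its comparison triangle in the hyperbolic plane. -/
def IsCATNegOne (X : Type*) [MetricSpace X] : Prop :=
  IsGeodesicSpace X ∧
    ∀ (Δ : GeodesicTriangle X) (v : Fin 3 → UpperHalfPlane), Δ.IsComparisonTriangle v →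
      ∀ (i j : Fin 3), ∀ x ∈ Δ.side i, ∀ y ∈ Δ.side j, ∀ x' y' : UpperHalfPlane,
        Δ.IsComparisonPoint v i x x' → Δ.IsComparisonPoint v j y y' → dist x y ≤ dist x' y'

open Real Set

/-! Multiplying by exponentials turns the claim into a four point inequality for the diagonals `xy`,
`zo` of a quadrilateral. Glue the comparison triangles of `x, y, z` and `x, y, o` along `xy`. If the
angles at `x` or at `y` add up to at least `π`, go from `z` to `o` through that vertex
(`exp_add_le_of_angle_sum_ge`). Otherwise continuity gives a point of `xy` where the two segments
form a straight line, and by `CAT(-1)` its distances to `z` and `o` are at most the comparison ones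
(`exp_add_le_of_crossing`). Either way `half_one_sub_le_exp_of_law_of_cosines` bounds the terms
below; at a crossing with angle `θ` this reduces to `sin² (θ/2) + cos² (θ/2) = 1`. -/

/-- If `C` is the cosine of the angle of a hyperbolic triangle between sides of length `p` and `q`,
and `r` is the length of the opposite side, then `exp (r - p - q)` is at least the square of the sine
of half the angle. -/
lemma half_one_sub_le_exp_of_law_of_cosines {p q r C : ℝ} (hp : 0 ≤ p) (hq : 0 ≤ q) (hr : 0 ≤ r)
    (hC : -1 ≤ C) (h : cosh r = cosh p * cosh q - C * (sinh p * sinh q)) :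
    (1 - C) / 2 ≤ exp (r - p - q) := by
  by_contra! hlt
  rw [exp_sub, exp_sub, div_div, div_lt_iff₀ (by positivity)] at hlt
  simp only [cosh_eq, sinh_eq, exp_neg] at h
  have hP := one_le_exp hp
  have hQ := one_le_exp hq
  have hR := one_le_exp hr
  generalize exp p = P at *
  generalize exp q = Q at *
  generalize exp r = R at *
  obtain ⟨k, rfl⟩ : ∃ k, C = 1 - 2 * k := ⟨(1 - C) / 2, by ring⟩
  have hk1 : k ≤ 1 := by linarith
  have hM : R < k * (P * Q) := by linarith
  have hPQ : 1 ≤ P * Q := one_le_mul_of_one_le_of_one_le hP hQ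
  have hk0 : 0 < k := by
    by_contra! hk
    nlinarith
  have h1 : R + R⁻¹ = (1 - k) * (P * Q⁻¹ + Q * P⁻¹) + k * (P * Q + P⁻¹ * Q⁻¹) := by linarith
  -- `R ↦ R + R⁻¹` increases strictly on `[1, ∞)`, and `1 ≤ R < k * (P * Q)`.
  have h2 : R + R⁻¹ < k * (P * Q) + (k * (P * Q))⁻¹ := by
    have hM0 : 0 < k * (P * Q) := by linarith
    have : k * (P * Q) + (k * (P * Q))⁻¹ - (R + R⁻¹) =
        (k * (P * Q) - R) * (k * (P * Q) * R - 1) / (k * (P * Q) * R) := by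
      field_simp
      ring
    have h3 : 1 < k * (P * Q) * R := by nlinarith
    have : 0 < (k * (P * Q) - R) * (k * (P * Q) * R - 1) / (k * (P * Q) * R) :=
      div_pos (mul_pos (by linarith) (by linarith)) (by linarith)
    linarith
  have h3 : (1 - k) * (P * Q⁻¹ + Q * P⁻¹) + k * (P * Q + P⁻¹ * Q⁻¹)
      - (k * (P * Q) + (k * (P * Q))⁻¹) =
      (1 - k) * (k * (P ^ 2 + Q ^ 2) - (1 + k)) / (k * (P * Q)) := by
    field_simp
    ring
  -- `k * (P ^ 2 + Q ^ 2) ≥ 2 * k * P * Q > 2 ≥ 1 + k`.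
  have h4 : 0 ≤ (1 - k) * (k * (P ^ 2 + Q ^ 2) - (1 + k)) / (k * (P * Q)) := by
    refine div_nonneg (mul_nonneg (by linarith) ?_) (by linarith)
    nlinarith [mul_nonneg hk0.le (sq_nonneg (P - Q))]
  linarith

/-- `(P * exp (-s) + Q * exp s) / 2` is the hyperbolic cosine of the distance from `i * exp s` to a
point of the upper half-plane. These are coefficients for a triangle with side lengths `a, b, c`. -/
lemma exists_hyperbolic_coefficients {a b c : ℝ} (ha : 0 ≤ a) (hb : 0 ≤ b) (hc : 0 < c)
    (habc : a ≤ b + c) (hbac : b ≤ a + c) (hcab : c ≤ a + b) :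
    ∃ P Q : ℝ, 0 < P ∧ 0 < Q ∧ 1 ≤ P * Q ∧ (P + Q) / 2 = cosh a ∧
      (P * exp (-c) + Q * exp c) / 2 = cosh b := by
  have hs : 0 < sinh c := sinh_pos_iff.2 hc
  have h1 : cosh (a - c) ≤ cosh b := by
    rw [cosh_le_cosh, abs_of_nonneg hb, abs_le]
    constructor <;> linarith
  have h2 : cosh b ≤ cosh (a + c) := by
    rw [cosh_le_cosh, abs_of_nonneg hb, abs_of_nonneg (by linarith)]
    linarith
  rw [cosh_sub] at h1
  rw [cosh_add] at h2
  have ea : sinh a < cosh a := sinh_lt_cosh a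
  have ea0 : 0 ≤ sinh a := sinh_nonneg_iff.2 ha
  have eP : exp c = cosh c + sinh c := (cosh_add_sinh c).symm
  have eN : exp (-c) = cosh c - sinh c := (cosh_sub_sinh c).symm
  have sa := cosh_sq a
  have sc := cosh_sq c
  have hP : 0 < (exp c * cosh a - cosh b) / sinh c := by
    refine div_pos ?_ hs
    rw [eP]
    nlinarith
  have hQ : 0 < (cosh b - exp (-c) * cosh a) / sinh c := by
    refine div_pos ?_ hs
    rw [eN]
    nlinarith
  refine ⟨_, _, hP, hQ, ?_, ?_, ?_⟩
  -- After clearing denominators this is `(cosh b - cosh a * cosh c) ^ 2 ≤ (sinh a * sinh c) ^ 2`,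
  -- which encodes the triangle inequalities.
  · rw [div_mul_div_comm, one_le_div (by positivity), eP, eN]
    have h3 : (cosh b - cosh a * cosh c) ^ 2 ≤ (sinh a * sinh c) ^ 2 := by
      rw [sq_le_sq, abs_of_nonneg (mul_nonneg ea0 hs.le), abs_le]
      constructor <;> linarith
    have h4 : (sinh a * sinh c) ^ 2 = (cosh a ^ 2 - 1) * (sinh c) ^ 2 := by rw [sa]; ring
    nlinarith
  · rw [eP, eN]
    field_simp
    ring
  · rw [eP, eN]
    field_simp
    ring

/-! ### Comparison triangles in the upper half-plane -/

namespace UpperHalfPlane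

/-- The point `i * exp s` of the upper half-plane. -/
noncomputable def imAxis (s : ℝ) : UpperHalfPlane := ⟨⟨0, exp s⟩, exp_pos s⟩

lemma dist_imAxis (s t : ℝ) : dist (imAxis s) (imAxis t) = |s - t| := by
  rw [UpperHalfPlane.dist_of_re_eq (show (imAxis s).re = (imAxis t).re from rfl)]
  change dist (Real.log (exp s)) (Real.log (exp t)) = _
  rw [Real.log_exp, Real.log_exp, Real.dist_eq]

/-- A point of the upper half-plane with prescribed distances to the points of the imaginary
axis. -/
lemma exists_cosh_dist_imAxis {P Q : ℝ} (hQ : 0 < Q) (hPQ : 1 ≤ P * Q) :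
    ∃ p : UpperHalfPlane, ∀ s, cosh (dist (imAxis s) p) = (P * exp (-s) + Q * exp s) / 2 := by
  have hQ' : 0 < Q⁻¹ := by positivity
  -- For a point `p` the coefficients are `Q = 1 / im p` and `P = |p|² / im p`; solve for `p`.
  refine ⟨⟨⟨√(P * Q - 1) * Q⁻¹, Q⁻¹⟩, hQ'⟩, fun s => ?_⟩
  rw [UpperHalfPlane.cosh_dist']
  change ((0 - √(P * Q - 1) * Q⁻¹) ^ 2 + exp s ^ 2 + Q⁻¹ ^ 2) / (2 * exp s * Q⁻¹) = _
  have := sq_sqrt (sub_nonneg.2 hPQ)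
  rw [zero_sub, neg_sq, mul_pow, this, exp_neg]
  field_simp
  ring

end UpperHalfPlane

open UpperHalfPlane

/-- In a `CAT(-1)` space, the distance from `z` to the points of a segment from `x` to `y` is
bounded by the corresponding distance in the comparison triangle. -/
lemma IsCATNegOne.exists_cosh_dist_le {X : Type*} [MetricSpace X] (hX : IsCATNegOne X) {x y : X}
    (hxy : x ≠ y) {S : Set X} (hS : IsGeodesicSegment x y S) (z : X) :
    ∃ P Q : ℝ, 0 < P ∧ 0 < Q ∧ 1 ≤ P * Q ∧ (P + Q) / 2 = cosh (dist z x) ∧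
      (P * exp (-dist x y) + Q * exp (dist x y)) / 2 = cosh (dist z y) ∧
      ∀ w ∈ S, dist x w + dist w y = dist x y →
        cosh (dist z w) ≤ (P * exp (-dist x w) + Q * exp (dist x w)) / 2 := by
  obtain ⟨P, Q, hP, hQ, hPQ, h0, hc⟩ := exists_hyperbolic_coefficients
    (a := dist z x) (b := dist z y) (c := dist x y) dist_nonneg dist_nonneg (dist_pos.2 hxy)
    (by rw [dist_comm x y]; exact dist_triangle z y x) (dist_triangle z x y)
    (by rw [dist_comm z x]; exact dist_triangle x z y)
  refine ⟨P, Q, hP, hQ, hPQ, h0, hc, fun w hw hws => ?_⟩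
  obtain ⟨p, hp⟩ := exists_cosh_dist_imAxis hQ hPQ
  obtain ⟨S₁, hS₁⟩ := hX.1 y z
  obtain ⟨S₂, hS₂⟩ := hX.1 z x
  have inj : ∀ {u v : ℝ}, 0 ≤ u → 0 ≤ v → cosh u = cosh v → u = v := fun hu hv h =>
    cosh_strictMonoOn.injOn hu hv h
  have hpx : dist (imAxis 0) p = dist z x :=
    inj dist_nonneg dist_nonneg (by rw [hp, ← h0]; simp)
  have hpy : dist (imAxis (dist x y)) p = dist z y :=
    inj dist_nonneg dist_nonneg (by rw [hp, ← hc])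
  let Δ : GeodesicTriangle X := ⟨![x, y, z], ![S, S₁, S₂], fun i => by
    fin_cases i
    exacts [hS, hS₁, hS₂]⟩
  have hz : z ∈ S₁ := by
    obtain ⟨γ, -, hγ, -, rfl⟩ := hS₁
    exact ⟨_, ⟨dist_nonneg, le_rfl⟩, hγ⟩
  have hv : Δ.IsComparisonTriangle ![imAxis 0, imAxis (dist x y), p] := fun i => by
    fin_cases i
    · change dist (imAxis 0) (imAxis (dist x y)) = dist x y
      rw [dist_imAxis, zero_sub, abs_neg, abs_of_nonneg dist_nonneg]
    · change dist (imAxis (dist x y)) p = dist y z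
      rw [hpy, dist_comm]
    · change dist p (imAxis 0) = dist z x
      rw [dist_comm, hpx]
  have key : dist w z ≤ dist (imAxis (dist x w)) p := by
    -- The vertex `z` is used as the far end of side `1`.
    refine hX.2 Δ _ hv 0 1 w hw z hz _ _ ⟨?_, ?_⟩ ⟨?_, ?_⟩
    · change dist (imAxis 0) (imAxis (dist x w)) = dist x w
      rw [dist_imAxis, zero_sub, abs_neg, abs_of_nonneg dist_nonneg]
    · change dist (imAxis (dist x w)) (imAxis (dist x y)) = dist w y
      rw [dist_imAxis, ← hws, sub_add_cancel_left, abs_neg, abs_of_nonneg dist_nonneg]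
    · change dist (imAxis (dist x y)) p = dist y z
      rw [hpy, dist_comm]
    · change dist p p = dist z z
      rw [dist_self, dist_self]
  rw [← hp, cosh_le_cosh, abs_of_nonneg dist_nonneg, abs_of_nonneg dist_nonneg, dist_comm]
  exact key

/-! ### The four point inequality -/

/-- Supplementary angles have opposite cosines. If `f` or `g` vanishes, the corresponding angle is
undefined and the other one dictates `C`. -/
lemma exists_common_ratio {u v f g : ℝ} (hu : |u| ≤ f) (hv : |v| ≤ g) (h : u * g + v * f = 0) :
    ∃ C : ℝ, |C| ≤ 1 ∧ u = C * f ∧ v = -C * g := by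
  rcases ((abs_nonneg u).trans hu).eq_or_lt' with rfl | hf
  · obtain rfl : u = 0 := abs_nonpos_iff.1 hu
    rcases ((abs_nonneg v).trans hv).eq_or_lt' with rfl | hg
    · obtain rfl : v = 0 := abs_nonpos_iff.1 hv
      exact ⟨0, by simp⟩
    · refine ⟨-(v / g), ?_, by simp, by field_simp⟩
      rwa [abs_neg, abs_div, abs_of_pos hg, div_le_one hg]
  · refine ⟨u / f, ?_, by field_simp, ?_⟩
    · rwa [abs_div, abs_of_pos hf, div_le_one hf]
    · field_simp
      linarith

lemma exists_ratios_add_nonneg {u v f g : ℝ} (hu : |u| ≤ f) (hv : |v| ≤ g)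
    (h : 0 ≤ u * g + v * f) :
    ∃ C D : ℝ, |C| ≤ 1 ∧ |D| ≤ 1 ∧ u = C * f ∧ v = D * g ∧ 0 ≤ C + D := by
  -- The default `C = 1` for `f = 0` makes `C + D ≥ 0` automatic, as `D ≥ -1`.
  have key : ∀ {u f : ℝ}, |u| ≤ f → ∃ C : ℝ, |C| ≤ 1 ∧ u = C * f ∧ (f = 0 → C = 1) := by
    intro u f hu
    rcases ((abs_nonneg u).trans hu).eq_or_lt' with rfl | hf
    · exact ⟨1, by simp, by simpa using hu, fun _ => rfl⟩
    · exact ⟨u / f, by rwa [abs_div, abs_of_pos hf, div_le_one hf], by field_simp,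
        fun h => absurd h hf.ne'⟩
  obtain ⟨C, hC, rfl, hC'⟩ := key hu
  obtain ⟨D, hD, rfl, hD'⟩ := key hv
  refine ⟨C, D, hC, hD, rfl, rfl, ?_⟩
  rw [abs_le] at hC hD
  rcases ((abs_nonneg _).trans hu).eq_or_lt' with rfl | hf
  · linarith [hC' rfl]
  rcases ((abs_nonneg _).trans hv).eq_or_lt' with rfl | hg
  · linarith [hD' rfl]
  have : 0 ≤ (C + D) * (f * g) := by linarith
  exact nonneg_of_mul_nonneg_left this (mul_pos hf hg)

/-- The case of the four point inequality in which the angles at `x` add up to at least `π`. Here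
`u` and `v` are the derivatives at `x`, in the direction of `y`, of the hyperbolic cosine of the
distances to `z` and `o` in the comparison triangles. -/
lemma exp_add_le_of_angle_sum_ge {a b c a' b' e u v : ℝ} (ha : 0 ≤ a) (hb : 0 ≤ b) (hc : 0 ≤ c)
    (ha' : 0 ≤ a') (hb' : 0 ≤ b') (he : e ≤ a + a') (hbac : b ≤ a + c) (hbac' : b' ≤ a' + c)
    (hu : |u| ≤ sinh a) (hv : |v| ≤ sinh a') (huv : 0 ≤ u * sinh a' + v * sinh a)
    (h : cosh b = cosh a * cosh c + u * sinh c) (h' : cosh b' = cosh a' * cosh c + v * sinh c) :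
    exp ((c + e) / 2) ≤ exp ((a + b') / 2) + exp ((b + a') / 2) := by
  obtain ⟨C, D, hC, hD, rfl, rfl, hCD⟩ := exists_ratios_add_nonneg hu hv huv
  rw [abs_le] at hC hD
  have h1 := half_one_sub_le_exp_of_law_of_cosines (C := -C) ha hc hb (by linarith)
    (by rw [h]; ring)
  have h2 := half_one_sub_le_exp_of_law_of_cosines (C := -D) ha' hc hb' (by linarith)
    (by rw [h']; ring)
  have h3 : exp (b - a - c) ≤ exp ((b - a - c) / 2) := exp_le_exp.2 (by linarith)
  have h4 : exp (b' - a' - c) ≤ exp ((b' - a' - c) / 2) := exp_le_exp.2 (by linarith)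
  calc exp ((c + e) / 2) ≤ 1 * exp ((c + a + a') / 2) := by
        rw [one_mul, exp_le_exp]; linarith
    _ ≤ (exp ((b' - a' - c) / 2) + exp ((b - a - c) / 2)) * exp ((c + a + a') / 2) := by
        gcongr
        linarith
    _ = exp ((a + b') / 2) + exp ((b + a') / 2) := by
        rw [add_mul, ← exp_add, ← exp_add]
        ring_nf

/-- The case of the four point inequality in which the diagonals meet, at distances `s` and `t` from
`x` and `y`, and at distances `f` and `g` from `z` and `o`. -/
lemma exp_add_le_of_crossing {a b a' b' s t f g e u v : ℝ} (ha : 0 ≤ a) (hb : 0 ≤ b)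
    (ha' : 0 ≤ a') (hb' : 0 ≤ b') (hs : 0 ≤ s) (ht : 0 ≤ t) (hf : 0 ≤ f) (hg : 0 ≤ g)
    (he : e ≤ f + g) (hu : |u| ≤ sinh f) (hv : |v| ≤ sinh g) (huv : u * sinh g + v * sinh f = 0)
    (hA : cosh a = cosh f * cosh s - u * sinh s) (hB : cosh b = cosh f * cosh t + u * sinh t)
    (hA' : cosh a' = cosh g * cosh s - v * sinh s) (hB' : cosh b' = cosh g * cosh t + v * sinh t) :
    exp ((s + t + e) / 2) ≤ exp ((a + b') / 2) + exp ((b + a') / 2) := by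
  obtain ⟨C, hC, rfl, rfl⟩ := exists_common_ratio hu hv huv
  rw [abs_le] at hC
  have h1 := half_one_sub_le_exp_of_law_of_cosines (C := C) hf hs ha (by linarith)
    (by rw [hA]; ring)
  have h2 := half_one_sub_le_exp_of_law_of_cosines (C := -C) hf ht hb (by linarith)
    (by rw [hB]; ring)
  have h3 := half_one_sub_le_exp_of_law_of_cosines (C := -C) hg hs ha' (by linarith)
    (by rw [hA']; ring)
  have h4 := half_one_sub_le_exp_of_law_of_cosines (C := C) hg ht hb' (by linarith)
    (by rw [hB']; ring)
  -- Vertically opposite angles agree, so their bounds combine by a geometric mean.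
  have key : ∀ {k p q : ℝ}, 0 ≤ k → k ≤ exp p → k ≤ exp q → k ≤ exp ((p + q) / 2) := by
    intro k p q hk hp hq
    refine le_of_sq_le_sq ?_ (exp_pos _).le
    rw [← exp_nat_mul, sq]
    calc k * k ≤ exp p * exp q := mul_le_mul hp hq hk (exp_pos _).le
      _ = _ := by rw [← exp_add]; congr 1; push_cast; ring
  have h5 := key (by linarith) h1 h4
  have h6 := key (by linarith) h2 h3
  calc exp ((s + t + e) / 2) ≤ 1 * exp ((s + t + f + g) / 2) := by
        rw [one_mul, exp_le_exp]; linarith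
    _ ≤ (exp ((a - f - s + (b' - g - t)) / 2) + exp ((b - f - t + (a' - g - s)) / 2))
        * exp ((s + t + f + g) / 2) := by
        gcongr
        linarith
    _ = exp ((a + b') / 2) + exp ((b + a') / 2) := by
        rw [add_mul, ← exp_add, ← exp_add]
        ring_nf

lemma IsCATNegOne.exp_dist_add_dist_le {X : Type*} [MetricSpace X] (hX : IsCATNegOne X)
    (x y z o : X) :
    exp ((dist x y + dist z o) / 2) ≤
      exp ((dist z x + dist o y) / 2) + exp ((dist z y + dist o x) / 2) := by
  have hzo : ∀ w, dist z o ≤ dist z w + dist o w := fun w => dist_triangle_right z o w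
  rcases eq_or_ne x y with rfl | hxy
  · have : exp ((dist x x + dist z o) / 2) ≤ exp ((dist z x + dist o x) / 2) :=
      exp_le_exp.2 (by rw [dist_self]; linarith [hzo x])
    linarith [exp_pos ((dist z x + dist o x) / 2)]
  obtain ⟨S, hS⟩ := hX.1 x y
  obtain ⟨P, Q, hP, hQ, hPQ, h0, hc, hw⟩ := hX.exists_cosh_dist_le hxy hS z
  obtain ⟨P', Q', hP', hQ', hPQ', h0', hc', hw'⟩ := hX.exists_cosh_dist_le hxy hS o
  set c := dist x y
  have hcpos : 0 < c := dist_pos.2 hxy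
  -- `sinh f ^ 2` exceeds the square of the derivative by `P * Q - 1`.
  have cosh_aux : ∀ {P Q : ℝ}, 1 ≤ P * Q → ∀ s f, 0 ≤ f →
      cosh f = (P * exp (-s) + Q * exp s) / 2 → |(Q * exp s - P * exp (-s)) / 2| ≤ sinh f := by
    intro P Q hPQ s f hf h
    refine abs_le_of_sq_le_sq ?_ (sinh_nonneg_iff.2 hf)
    rw [sinh_sq, h]
    have : exp (-s) * exp s = 1 := by rw [← exp_add]; simp
    linear_combination hPQ + (-P * Q) * this
  have trans_aux : ∀ P Q s t : ℝ, (P * exp (-(s + t)) + Q * exp (s + t)) / 2 =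
      (P * exp (-s) + Q * exp s) / 2 * cosh t + (Q * exp s - P * exp (-s)) / 2 * sinh t := by
    intro P Q s t
    rw [cosh_eq, sinh_eq, neg_add, exp_add, exp_add]
    ring
  have back : ∀ P Q s : ℝ, (P * exp (-0) + Q * exp 0) / 2 =
      (P * exp (-s) + Q * exp s) / 2 * cosh s - (Q * exp s - P * exp (-s)) / 2 * sinh s := by
    intro P Q s
    have := trans_aux P Q s (-s)
    rw [add_neg_cancel, cosh_neg, sinh_neg] at this
    linarith
  let H : ℝ → ℝ := fun s => (P * exp (-s) + Q * exp s) / 2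
  let H' : ℝ → ℝ := fun s => (Q * exp s - P * exp (-s)) / 2
  let K : ℝ → ℝ := fun s => (P' * exp (-s) + Q' * exp s) / 2
  let K' : ℝ → ℝ := fun s => (Q' * exp s - P' * exp (-s)) / 2
  have hH0 : cosh (dist z x) = H 0 := by simp [H, ← h0]
  have hK0 : cosh (dist o x) = K 0 := by simp [K, ← h0']
  have hHc : cosh (dist z y) = H c := hc.symm
  have hKc : cosh (dist o y) = K c := hc'.symm
  have sinh_eq_sqrt : ∀ f, 0 ≤ f → sinh f = √(cosh f ^ 2 - 1) := fun f hf => by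
    rw [← sinh_sq, sqrt_sq (sinh_nonneg_iff.2 hf)]
  -- The roots are the `sinh` of the comparison distances, so where these are positive the sign of
  -- `Φ` is opposite to that of the sum of the cosines of the angles with the direction of `y`.
  let Φ : ℝ → ℝ := fun s => H' s * √(K s ^ 2 - 1) + K' s * √(H s ^ 2 - 1)
  have hΦ : Continuous Φ := by fun_prop
  have tzx := dist_triangle z x y
  have tox := dist_triangle o x y
  have tzy := dist_triangle z y x
  have toy := dist_triangle o y x
  rw [dist_comm y x] at tzy toy
  rcases le_total 0 (Φ 0) with hΦ0 | hΦ0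
  · refine exp_add_le_of_angle_sum_ge (u := H' 0) (v := K' 0) dist_nonneg dist_nonneg dist_nonneg
      dist_nonneg dist_nonneg (hzo x) tzx tox (cosh_aux hPQ 0 _ dist_nonneg hH0)
      (cosh_aux hPQ' 0 _ dist_nonneg hK0) ?_ ?_ ?_
    · rwa [sinh_eq_sqrt _ dist_nonneg, sinh_eq_sqrt _ dist_nonneg, hH0, hK0]
    · rw [hHc, hH0]
      have := trans_aux P Q 0 c
      rwa [zero_add] at this
    · rw [hKc, hK0]
      have := trans_aux P' Q' 0 c
      rwa [zero_add] at this
  rcases le_total (Φ c) 0 with hΦc | hΦc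
  · rw [add_comm (exp _)]
    -- Exchanging `x` and `y` reverses the direction of the derivatives.
    refine exp_add_le_of_angle_sum_ge (u := -H' c) (v := -K' c) dist_nonneg dist_nonneg dist_nonneg
      dist_nonneg dist_nonneg (hzo y) tzy toy ?_ ?_ ?_ ?_ ?_
    · rw [abs_neg]; exact cosh_aux hPQ c _ dist_nonneg hHc
    · rw [abs_neg]; exact cosh_aux hPQ' c _ dist_nonneg hKc
    · rw [sinh_eq_sqrt _ dist_nonneg, sinh_eq_sqrt _ dist_nonneg, hHc, hKc]
      linarith
    · rw [hHc, hH0, neg_mul, ← sub_eq_add_neg]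
      exact back P Q c
    · rw [hKc, hK0, neg_mul, ← sub_eq_add_neg]
      exact back P' Q' c
  obtain ⟨s, ⟨hs0, hsc⟩, hs⟩ := intermediate_value_Icc hcpos.le hΦ.continuousOn ⟨hΦ0, hΦc⟩
  obtain ⟨γ, hγ0, hγc, hγ, rfl⟩ := hS
  have hxs : dist x (γ s) = s := by
    rw [← hγ0, hγ 0 ⟨le_rfl, hcpos.le⟩ s ⟨hs0, hsc⟩, zero_sub, abs_neg, abs_of_nonneg hs0]
  have hsy : dist (γ s) y = c - s := by
    rw [← hγc, hγ s ⟨hs0, hsc⟩ c ⟨hcpos.le, le_rfl⟩, abs_sub_comm, abs_of_nonneg (by linarith)]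
  have hz := hw (γ s) ⟨s, ⟨hs0, hsc⟩, rfl⟩ (by rw [hxs, hsy]; ring)
  have ho := hw' (γ s) ⟨s, ⟨hs0, hsc⟩, rfl⟩ (by rw [hxs, hsy]; ring)
  rw [hxs] at hz ho
  -- Recovers the comparison distances `f`, `g` from their `cosh`; they dominate the true distances
  -- to `γ s`.
  have exists_dist : ∀ {d h : ℝ}, 0 ≤ d → cosh d ≤ h → ∃ f, 0 ≤ f ∧ d ≤ f ∧ cosh f = h := by
    intro d h hd hdh
    have h1 : 1 ≤ h := (one_le_cosh d).trans hdh
    have h2 : cosh (arcosh h) = h := cosh_arcosh h1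
    have h3 : 0 ≤ arcosh h := arcosh_nonneg h1
    refine ⟨arcosh h, h3, ?_, h2⟩
    rwa [← h2, cosh_le_cosh, abs_of_nonneg hd, abs_of_nonneg h3] at hdh
  obtain ⟨f, hf0, hzf, hf⟩ := exists_dist dist_nonneg hz
  obtain ⟨g, hg0, hog, hg⟩ := exists_dist dist_nonneg ho
  have forth : ∀ P Q : ℝ, (P * exp (-c) + Q * exp c) / 2 =
      (P * exp (-s) + Q * exp s) / 2 * cosh (c - s) +
        (Q * exp s - P * exp (-s)) / 2 * sinh (c - s) := by
    intro P Q
    have := trans_aux P Q s (c - s)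
    rwa [add_sub_cancel] at this
  rw [show c = s + (c - s) by ring]
  refine exp_add_le_of_crossing (u := H' s) (v := K' s) dist_nonneg dist_nonneg dist_nonneg
    dist_nonneg hs0 (by linarith) hf0 hg0 (by linarith [hzo (γ s)]) (cosh_aux hPQ s f hf0 hf)
    (cosh_aux hPQ' s g hg0 hg) ?_ ?_ ?_ ?_ ?_
  · rw [sinh_eq_sqrt _ hf0, sinh_eq_sqrt _ hg0, hf, hg]
    exact hs
  · rw [hH0, hf]; exact back P Q s
  · rw [hHc, hf]; exact forth P Q
  · rw [hK0, hg]; exact back P' Q' s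
  · rw [hKc, hg]; exact forth P' Q'

theorem theorem5p1 (X : Type*) [MetricSpace X] (hX : IsCATNegOne X) :
    StronglyHyperbolic X 1 := by
  refine ⟨one_pos, fun x y z o => ?_⟩
  have h := mul_le_mul_of_nonneg_right (hX.exp_dist_add_dist_le x y z o)
    (exp_pos (-(dist x o + dist y o + dist z o) / 2)).le
  rw [add_mul, ← exp_add, ← exp_add, ← exp_add] at h
  unfold gromovProduct
  rw [dist_comm z x, dist_comm o y, dist_comm o x] at h
  refine (le_of_eq ?_).trans (h.trans (le_of_eq ?_))
  · congr 1
    ring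
  · congr 2 <;> ring
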